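/- Consider a queueing network with $J$ customer classes and $K$ servers. The classes are partitioned into nonempty sets $C(1),\dots,C(K)$, where $C(k)$ is the set of classes served by server $k$. A class $i$ customer, once served, becomes a class $r(i)\in\{0,1,\dots,J\}$ customer, where $0$ is the outside, and the network is open: every route $i, r(i), r(r(i)),\dots$ eventually reaches $0$. The arrival and service rates satisfy $\lambda_i\ge 0$ and $\mu_i>0$. Let $e_1,\dots,e_J$ be the standard basis of $\mathbb R^J$, $e_0=0$, $\gamma_i=e_i-e_{r(i)}$, $\mathcal J_+=\{i:\lambda_i>0\}$, and $I(x)=\{i:x_i=0\}$. Fix $c>0$ and $b>0$. Let $$U=\Big\{u\in[0,\infty)^J:\ \sum_{i\in C(k)}u_i\le 1,\ k=1,\dots,K\Big\},\qquad M^b=\{m=(\bar\lambda,\bar\mu)\in[0,b]^{2J}\},$$ $$v(u,m)=\sum_j\bar\lambda_je_j-\sum_iu_i\bar\mu_i\gamma_i,\qquad \rho(u,m)=\sum_i\lambda_i\, l\big(\bar\lambda_i/\lambda_i\big)+\sum_iu_i\mu_i\, l\big(\bar\mu_i/\mu_i\big),$$ where $l(x)=x\log x-x+1$, $0\log 0=0$;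 if $\lambda_i=0$ the $i$-th arrival term is $0$ when $\bar\lambda_i=0$, and $\rho(u,m)=\infty$ when $\bar\lambda_i>0$. Let $$H(q)=\inf_{m\in M^b}\ \sup_{u\in U}\ \big[\langle q,v(u,m)\rangle+\rho(u,m)+c\big],\qquad q\in\mathbb R^J.$$ Let $G\subset\mathbb R^J_+$ be of one of the following two types. 1. $G=\{x: 0\le x_i<z_i \text{ for } i\in\mathcal J_+,\ 0\le x_j\le z_j \text{ for } j\notin\mathcal J_+\}$ for some $z_1,\dots,z_J>0$; in this case put $\partial_cG=\{x\in G:\ x_j=z_j\text{ for some }j\notin\mathcal J_+\}$. 2. $G=\{x\in\mathbb R^J_+:\ x_i<\phi_i(x_1,\dots,x_{i-1},x_{i+1},\dots,x_J)\ \text{for all } i\in\mathcal J_+\}$ with positive Lipschitz functions $\phi_i:\mathbb R^{J-1}\to\mathbb R$, and $G$ is bounded and simply connected; in this case put $\partial_cG=\emptyset$. Let $\partial_oG=\partial G\setminus G$ and $\partial_+G=(G\cap\partial\mathbb R^J_+)\setminus\partial_cG$. Consider the problem $$H(DV)=0\ \text{ in } G^o,\qquad \langle DV(x),\gamma_i\rangle=0\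 \text{ for } i\in I(x),\ x\in\partial_+G,\qquad V=0\ \text{ on }\partial_oG, \tag{P}$$ with a state-space constraint on $\partial_cG$, in the following viscosity sense. For $X\subset G$, a Lipschitz function $w:X\to\mathbb R$, identified with its Lipschitz extension to $\bar X$, is a subsolution (respectively supersolution) on $X$ if for every $C^1$ function $\theta$ and every local maximum (respectively minimum) $y\in X$ of $w-\theta$ over $X$, $$H(D\theta(y))\vee\max_{i\in I(y)}\langle D\theta(y),\gamma_i\rangle\ge 0\qquad\Big(\text{respectively } H(D\theta(y))\wedge\min_{i\in I(y)}\langle D\theta(y),\gamma_i\rangle\le 0\Big),$$ where the maximum or minimum over $I(y)$ is omitted if $I(y)=\emptyset$, and $w\le 0$ (respectively $w\ge 0$) on $\bar X\cap\partial_oG$. A subsolution of (P) is a subsolution on $G$; a supersolution of (P) is a supersolution on $G\setminus\partial_cG$. Then every subsolution $u$ of (P) and every supersolution $v$ of (P) satisfy $u\le v$ on $G$, where the values of $v$ on $\partial_cG$ are those of its Lipschitz extension. -/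

import Mathlib

open scoped Gradient

noncomputable section

namespace EscapeTime

/-- The state space `ℝ^J` with its Euclidean structure. -/
abbrev Space (J : ℕ) : Type := EuclideanSpace ℝ (Fin J)

/-- A queueing network with `J` customer classes and `K` servers. -/
structure Network (J K : ℕ) where
  /-- The server of each class; `C(k)` is the fibre over `k`. -/
  server : Fin J → Fin K
  /-- Each server serves at least one class. -/
  server_surjective : Function.Surjective server
  /-- A served customer of class `i` turns into class `route i`; `none` is the outside. -/
  route : Fin J → Option (Fin J)
  /-- The network is open: the route started from any class ends outside. -/
  route_exits : ∀ i, ∃ n : ℕ, (fun o : Option (Fin J) => o.bind route)^[n] (some i) = none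
  /-- Arrival rates. -/
  lam : Fin J → ℝ
  lam_nonneg : ∀ i, 0 ≤ lam i
  /-- Service rates. -/
  mu : Fin J → ℝ
  mu_pos : ∀ i, 0 < mu i

/-- The unit vectors `e_i`, with `e_0 = 0` for the outside. -/
def unitVec {J : ℕ} : Option (Fin J) → Space J
  | none => 0
  | some i => EuclideanSpace.single i 1

/-- `l(x) = x log x - x + 1` with `0 log 0 = 0`; it is used only at arguments `x ≥ 0`. -/
def ell (x : ℝ) : ℝ := x * Real.log x - x + 1

/-- The perturbed rates `m = (λbar, μbar)`. -/
abbrev Rates (J : ℕ) : Type := (Fin J → ℝ) × (Fin J → ℝ)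

/-- The bounded set of perturbed rates `M^b = [0, b]^{2J}`. -/
def ratesUpTo (J : ℕ) (b : ℝ) : Set (Rates J) :=
  {m | (∀ i, 0 ≤ m.1 i ∧ m.1 i ≤ b) ∧ (∀ i, 0 ≤ m.2 i ∧ m.2 i ≤ b)}

namespace Network

variable {J K : ℕ} (N : Network J K)

/-- The constraint directions `γ_i = e_i - e_{r(i)}`. -/
def gamma (i : Fin J) : Space J := unitVec (some i) - unitVec (N.route i)

/-- The set `U` of service allocations. -/
def controls : Set (Fin J → ℝ) :=
  {u | (∀ i, 0 ≤ u i) ∧ ∀ k : Fin K, (∑ i : Fin J with N.server i = k, u i) ≤ 1}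

/-- The velocity `v(u, m) = ∑ λbar_j e_j + ∑ u_i μbar_i (e_{r(i)} - e_i)`. -/
def velocity (u : Fin J → ℝ) (m : Rates J) : Space J :=
  (∑ j, m.1 j • unitVec (some j)) +
    ∑ i, (u i * m.2 i) • (unitVec (N.route i) - unitVec (some i))

open Classical in
/-- The running cost `ρ(u, m)`, with `ρ = ∞` if `λ_i = 0` and `λbar_i > 0` for some `i`. (A term with
`λ_i = λbar_i = 0` contributes `0 * l(0 / 0) = 0`.) -/
def rho (u : Fin J → ℝ) (m : Rates J) : EReal :=
  if ∃ i, N.lam i = 0 ∧ 0 < m.1 i then ⊤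
  else (((∑ i, N.lam i * ell (m.1 i / N.lam i)) +
    ∑ i, u i * N.mu i * ell (m.2 i / N.mu i) : ℝ) : EReal)

/-- The Hamiltonian `H(q) = inf_{m ∈ M^b} sup_{u ∈ U} [⟨q, v(u, m)⟩ + ρ(u, m) + c]`. -/
def hamiltonian (b c : ℝ) (q : Space J) : EReal :=
  ⨅ m ∈ ratesUpTo J b, ⨆ u ∈ N.controls,
    ((inner ℝ q (N.velocity u m) + c : ℝ) : EReal) + N.rho u m

/-- The rectangle with sides `z_i`: half-open in the coordinates with `λ_i > 0`, closed in the others. -/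
def rectangle (z : Fin J → ℝ) : Set (Space J) :=
  {x | ∀ i, 0 ≤ x i ∧ (0 < N.lam i → x i < z i) ∧ (¬ 0 < N.lam i → x i ≤ z i)}

/-- The part `∂_c G` of the boundary of the rectangle. -/
def rectangleBlocked (z : Fin J → ℝ) : Set (Space J) :=
  {x | x ∈ N.rectangle z ∧ ∃ j, ¬ 0 < N.lam j ∧ x j = z j}

/-- The region `⋂_{λ_i > 0} G_i` of the nonnegative orthant, where `G_i` is given by `x_i < φ_i(x_j, j ≠ i)`. -/
def subgraphRegion (phi : (i : Fin J) → ({j : Fin J // j ≠ i} → ℝ) → ℝ) : Set (Space J) :=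
  {x | (∀ i, 0 ≤ x i) ∧ ∀ i, 0 < N.lam i → x i < phi i (fun j => x j)}

/-- `N.IsDomain G Gc`: the set `G` is one of the admissible domains, and `Gc` is its boundary part `∂_c G`
on which exit can be blocked. -/
inductive IsDomain : Set (Space J) → Set (Space J) → Prop
  | rectangle (z : Fin J → ℝ) (hz : ∀ i, 0 < z i) :
      IsDomain (N.rectangle z) (N.rectangleBlocked z)
  | subgraph (phi : (i : Fin J) → ({j : Fin J // j ≠ i} → ℝ) → ℝ)
      (hpos : ∀ i, 0 < N.lam i → ∀ w, 0 < phi i w)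
      (hlip : ∀ i, 0 < N.lam i → ∃ L : NNReal, LipschitzWith L (phi i))
      (hbdd : Bornology.IsBounded (N.subgraphRegion phi))
      (hsc : SimplyConnectedSpace (N.subgraphRegion phi)) :
      IsDomain (N.subgraphRegion phi) ∅

end Network

/-- The exit boundary `∂_o G = ∂G \ G`. -/
def exitBoundary {J : ℕ} (G : Set (Space J)) : Set (Space J) := frontier G \ G

/-- Lipschitz viscosity subsolutions on `X ⊆ G`. A Lipschitz function on `X` is identified with its
unique Lipschitz extension to the closure of `X`; values off the closure are irrelevant. -/
structure IsSubsolution {J K : ℕ} (N : Network J K) (b c : ℝ) (G X : Set (Space J))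
    (u : Space J → ℝ) : Prop where
  lipschitz : ∃ L : NNReal, LipschitzOnWith L u (closure X)
  viscosity : ∀ θ : Space J → ℝ, ContDiff ℝ 1 θ → ∀ y ∈ X,
    IsLocalMaxOn (fun x => u x - θ x) X y →
      0 ≤ N.hamiltonian b c (∇ θ y) ∨ ∃ i, y i = 0 ∧ 0 ≤ inner ℝ (∇ θ y) (N.gamma i)
  boundary : ∀ x ∈ closure X ∩ exitBoundary G, u x ≤ 0

/-- Lipschitz viscosity supersolutions on `X ⊆ G`, with the same convention. -/
structure IsSupersolution {J K : ℕ} (N : Network J K) (b c : ℝ) (G X : Set (Space J))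
    (v : Space J → ℝ) : Prop where
  lipschitz : ∃ L : NNReal, LipschitzOnWith L v (closure X)
  viscosity : ∀ θ : Space J → ℝ, ContDiff ℝ 1 θ → ∀ y ∈ X,
    IsLocalMinOn (fun x => v x - θ x) X y →
      N.hamiltonian b c (∇ θ y) ≤ 0 ∨ ∃ i, y i = 0 ∧ inner ℝ (∇ θ y) (N.gamma i) ≤ 0
  boundary : ∀ x ∈ closure X ∩ exitBoundary G, 0 ≤ v x

end EscapeTime

end

open scoped Gradient

noncomputable section

namespace EscapeTime

namespace Network

variable {J K : ℕ} (N : Network J K)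

/-! Suppose `u z₀ > v z₀` and double variables: maximize `κ u(x) - v(y) - g(σx - y) + δ⟨β,x⟩ +
δ⟨β,y⟩` over the closure of `G`, squared.

The constraint directions are oblique, so `g` is built from the basis `ω` dual to the `γ_i`. It
penalizes the distance to a box whose sides solve the traffic equations. Near the box, `⟨Dg(z),
γ_i⟩` weakly has the sign of `z_i` (`inner_boxPenaltyGrad_gamma_sign`). Since `⟨β, γ_i⟩ = 1`, the
`δ` terms make this strict, ruling out the reflection alternatives at both points.

Only the Hamiltonian inequalities remain, at momenta `q`, `q'` with `(κ/σ) q - q' = O(δ)` however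
steep `g` is. As `ρ ≥ 0`, they force `(1 - κ/σ) c = O(δ)` (`hamiltonian_strict_contraction`), absurd
for `κ < σ` and `δ` small.

The scaling `σ` keeps `y` off `∂_cG`, where `v` satisfies no inequality. The boundary values and
Lipschitz bounds exclude `∂_oG`. -/

/-! ### Running cost, velocity and Hamiltonian -/

theorem ell_nonneg {x : ℝ} (hx : 0 ≤ x) : 0 ≤ ell x := by
  unfold ell
  rcases hx.eq_or_lt with rfl | h
  · simp
  · have h1 := Real.one_sub_inv_le_log_of_pos h
    have h2 := mul_le_mul_of_nonneg_left h1 hx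
    have h3 : x * (1 - x⁻¹) = x - 1 := by field_simp
    linarith

/-- The real value of the running cost where it is finite. -/
def rhoReal (u : Fin J → ℝ) (m : Rates J) : ℝ :=
  (∑ i, N.lam i * ell (m.1 i / N.lam i)) + ∑ i, u i * N.mu i * ell (m.2 i / N.mu i)

theorem rhoReal_nonneg {b : ℝ} {u : Fin J → ℝ} {m : Rates J} (hu : u ∈ N.controls)
    (hm : m ∈ ratesUpTo J b) : 0 ≤ N.rhoReal u m := by
  refine add_nonneg (Finset.sum_nonneg fun i _ => ?_) (Finset.sum_nonneg fun i _ => ?_)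
  · exact mul_nonneg (N.lam_nonneg i) (ell_nonneg (div_nonneg (hm.1 i).1 (N.lam_nonneg i)))
  · exact mul_nonneg (mul_nonneg (hu.1 i) (N.mu_pos i).le)
      (ell_nonneg (div_nonneg (hm.2 i).1 (N.mu_pos i).le))

theorem le_one_of_mem_controls {u : Fin J → ℝ} (hu : u ∈ N.controls) (i : Fin J) : u i ≤ 1 :=
  (Finset.single_le_sum (f := u) (fun j _ => hu.1 j) (by simp)).trans (hu.2 (N.server i))

theorem zero_mem_controls : (0 : Fin J → ℝ) ∈ N.controls := by
  simp [controls]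

theorem exists_norm_velocity_le (b : ℝ) :
    ∃ C : ℝ, 0 ≤ C ∧ ∀ u ∈ N.controls, ∀ m ∈ ratesUpTo J b, ‖N.velocity u m‖ ≤ C := by
  refine ⟨(∑ j : Fin J, |b| * ‖(unitVec (some j) : Space J)‖) +
    ∑ i, |b| * ‖(unitVec (N.route i) - unitVec (some i) : Space J)‖, by positivity,
    fun u hu m hm => ?_⟩
  unfold velocity
  refine (norm_add_le _ _).trans (add_le_add ?_ ?_)
  · refine (norm_sum_le _ _).trans (Finset.sum_le_sum fun i _ => ?_)
    rw [norm_smul, Real.norm_eq_abs, abs_of_nonneg (hm.1 i).1]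
    gcongr
    exact (hm.1 i).2.trans (le_abs_self b)
  · refine (norm_sum_le _ _).trans (Finset.sum_le_sum fun i _ => ?_)
    rw [norm_smul, Real.norm_eq_abs, abs_of_nonneg (mul_nonneg (hu.1 i) (hm.2 i).1)]
    gcongr
    calc u i * m.2 i ≤ 1 * m.2 i :=
          mul_le_mul_of_nonneg_right (N.le_one_of_mem_controls hu i) (hm.2 i).1
      _ ≤ |b| := by rw [one_mul]; exact (hm.2 i).2.trans (le_abs_self b)

/-- Quantitative strictness of the Hamiltonian under contractions of the momentum. -/
theorem hamiltonian_strict_contraction {b c C κ η : ℝ} (hκ0 : 0 ≤ κ) (hκ1 : κ ≤ 1)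
    (hC : ∀ u ∈ N.controls, ∀ m ∈ ratesUpTo J b, ‖N.velocity u m‖ ≤ C)
    {q q' : Space J} (hq : 0 ≤ N.hamiltonian b c q) (hq' : N.hamiltonian b c q' ≤ 0)
    (hqq' : ‖κ • q - q'‖ ≤ η) : (1 - κ) * c ≤ C * η := by
  refine le_of_forall_pos_le_add fun t ht => ?_
  have ht2 : (0 : EReal) < ((t / 2 : ℝ) : EReal) := by exact_mod_cast half_pos ht
  have ht2' : ((-(t / 2) : ℝ) : EReal) < 0 := by exact_mod_cast neg_lt_zero.2 (half_pos ht)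
  obtain ⟨m, hm, hlt⟩ : ∃ m ∈ ratesUpTo J b, (⨆ u ∈ N.controls,
      ((inner ℝ q' (N.velocity u m) + c : ℝ) : EReal) + N.rho u m) < ((t / 2 : ℝ) : EReal) := by
    have h := hq'.trans_lt ht2
    simpa only [hamiltonian, iInf_lt_iff, exists_prop] using h
  -- Whether `ρ` is infinite depends on `m` alone, so finiteness of the supremum, tested at `u = 0`,
  -- makes `ρ` finite for every control.
  have hrho : ∀ u, N.rho u m = (N.rhoReal u m : EReal) := by
    intro u
    unfold rho rhoReal
    refine if_neg fun h => ?_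
    have h0 := (le_iSup₂ (f := fun u (_ : u ∈ N.controls) =>
      ((inner ℝ q' (N.velocity u m) + c : ℝ) : EReal) + N.rho u m) 0 N.zero_mem_controls).trans_lt hlt
    simp only [rho, if_pos h, EReal.coe_add_top] at h0
    exact not_top_lt h0
  -- The rates are nearly optimal for `q'`, the control nearly optimal for `q` against those rates;
  -- both inequalities hold at this one pair.
  obtain ⟨u, hu, hgt⟩ : ∃ u ∈ N.controls, ((-(t / 2) : ℝ) : EReal) <
      ((inner ℝ q (N.velocity u m) + c : ℝ) : EReal) + N.rho u m := by
    have h := ht2'.trans_le (hq.trans (iInf₂_le m hm))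
    simpa only [lt_iSup_iff, exists_prop] using h
  have hlt' := (le_iSup₂ (f := fun u (_ : u ∈ N.controls) =>
      ((inner ℝ q' (N.velocity u m) + c : ℝ) : EReal) + N.rho u m) u hu).trans_lt hlt
  rw [hrho u] at hgt hlt'
  norm_cast at hgt hlt'
  have hρ := N.rhoReal_nonneg hu hm
  have hin : inner ℝ (κ • q - q') (N.velocity u m) ≤ C * η :=
    (real_inner_le_norm _ _).trans (by
      rw [mul_comm]
      exact mul_le_mul (hC u hu m hm) hqq' (norm_nonneg _) ((norm_nonneg _).trans (hC u hu m hm)))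
  rw [inner_sub_left, real_inner_smul_left] at hin
  -- Subtracting the `q'` bound from `κ` times the `q` bound leaves `(1 - κ)(ρ + c)`, from which `ρ
  -- ≥ 0` is dropped.
  nlinarith [mul_nonneg (sub_nonneg.2 hκ1) hρ, mul_lt_mul_of_pos_left hgt ht,
    mul_le_mul_of_nonneg_left hgt.le hκ0]

/-! ### The dual basis of the constraint directions -/

/-- One routing step. -/
def step (o : Option (Fin J)) : Option (Fin J) := o.bind N.route

theorem step_iterate_none (n : ℕ) : N.step^[n] none = none :=
  Function.iterate_fixed rfl n

theorem exists_step_iterate_eq_none : ∃ n, ∀ i, N.step^[n] (some i) = none := by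
  choose k hk using N.route_exits
  refine ⟨∑ i, k i, fun i => ?_⟩
  have hle : k i ≤ ∑ i, k i := Finset.single_le_sum (fun _ _ => Nat.zero_le _) (Finset.mem_univ i)
  obtain ⟨d, hd⟩ := Nat.exists_eq_add_of_le hle
  have hki : N.step^[k i] (some i) = none := hk i
  rw [hd, add_comm, Function.iterate_add_apply, hki, step_iterate_none]

/-- The number of visits to `i` before time `n` of the route started at `o`. -/
def visits (n : ℕ) (i : Fin J) (o : Option (Fin J)) : ℝ :=
  ∑ k ∈ Finset.range n, if N.step^[k] o = some i then 1 else 0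

theorem visits_none (n : ℕ) (i : Fin J) : N.visits n i none = 0 := by
  simp [visits, step_iterate_none]

/-- Starting at `r(j)` shifts the route by one step, so the sum telescopes; the last term vanishes
because the route has left by time `n`. -/
theorem visits_sub_visits_route {n : ℕ} (hn : ∀ i, N.step^[n] (some i) = none) (i j : Fin J) :
    N.visits n i (some j) - N.visits n i (N.route j) = if i = j then 1 else 0 := by
  have h : ∀ k, N.step^[k] (N.route j) = N.step^[k + 1] (some j) := fun k => by
    rw [Function.iterate_succ_apply]; rfl
  simp only [visits, h]
  rw [← Finset.sum_sub_distrib, Finset.sum_range_sub'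
    (fun k => if N.step^[k] (some j) = some i then (1 : ℝ) else 0)]
  simp [hn, eq_comm]

/-- Coordinates of a vector in terms of its coefficients with respect to the constraint directions. -/
theorem apply_eq_of_expansion {z : Space J} {w : Fin J → ℝ} (h : z = ∑ j, w j • N.gamma j)
    (i : Fin J) : z i = w i - ∑ j with N.route j = some i, w j := by
  have hroute : ∀ o : Option (Fin J), (unitVec o : Space J) i = if o = some i then 1 else 0 := by
    rintro (_ | k) <;> simp [unitVec, eq_comm]
  conv_lhs => rw [h]
  simp [gamma, hroute, mul_sub, Finset.sum_sub_distrib, Finset.sum_filter]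

/-- The `j`-th coordinate of `ω i` counts visits to `i` of the route from `j`. The weight `a i`
totals them over `j`; its recursion is the traffic equation with unit input, read off from the
expansion of the all-ones vector. -/
theorem exists_dual_basis : ∃ (ω : Fin J → Space J) (a : Fin J → ℝ),
    (∀ i j, inner ℝ (ω i) (N.gamma j) = if i = j then (1 : ℝ) else 0) ∧
    (∀ z : Space J, z = ∑ j, (inner ℝ (ω j) z : ℝ) • N.gamma j) ∧
    (∀ i, 0 ≤ a i) ∧ ∀ i, a i = 1 + ∑ j with N.route j = some i, a j := by
  obtain ⟨n, hn⟩ := N.exists_step_iterate_eq_none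
  let ω : Fin J → Space J := fun i => WithLp.toLp 2 fun j => N.visits n i (some j)
  have hunit : ∀ i o, inner ℝ (ω i) (unitVec o : Space J) = N.visits n i o := by
    rintro i (_ | k)
    · simp [unitVec, visits_none]
    · simp [unitVec, ω, EuclideanSpace.inner_single_right]
  have hdual : ∀ i j, inner ℝ (ω i) (N.gamma j) = if i = j then (1 : ℝ) else 0 := fun i j => by
    rw [gamma, inner_sub_right, hunit, hunit, N.visits_sub_visits_route hn]
  have hcoef : ∀ (w : Fin J → ℝ) i, inner ℝ (ω i) (∑ j, w j • N.gamma j) = w i := fun w i => by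
    simp [inner_sum, real_inner_smul_right, hdual]
  have hli : LinearIndependent ℝ N.gamma := by
    rw [Fintype.linearIndependent_iff]
    intro w hw i
    rw [← hcoef w i, hw, inner_zero_right]
  have hspan := hli.span_eq_top_of_card_eq_finrank' (by simp)
  have hexp : ∀ z : Space J, z = ∑ j, (inner ℝ (ω j) z : ℝ) • N.gamma j := by
    intro z
    have hz : z ∈ Submodule.span ℝ (Set.range N.gamma) := hspan ▸ Submodule.mem_top
    obtain ⟨w, rfl⟩ := (Submodule.mem_span_range_iff_exists_fun ℝ).1 hz
    simp only [hcoef]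
  let e : Space J := WithLp.toLp 2 fun _ => 1
  refine ⟨ω, fun i => inner ℝ (ω i) e, hdual, hexp, fun i => ?_, fun i => ?_⟩
  · have : inner ℝ (ω i) e = ∑ j, N.visits n i (some j) := by
      simp [ω, e, PiLp.inner_apply]
    simp only [this]
    refine Finset.sum_nonneg fun j _ => Finset.sum_nonneg fun k _ => ?_
    split_ifs <;> norm_num
  · have h := N.apply_eq_of_expansion (hexp e) i
    have h1 : e i = 1 := rfl
    linarith

end Network

section

/-! ### The penalty function -/

theorem hasDerivAt_max_zero_sq (t : ℝ) :
    HasDerivAt (fun s : ℝ => max s 0 ^ 2) (2 * max t 0) t := by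
  rcases lt_trichotomy t 0 with h | rfl | h
  · rw [max_eq_right h.le, mul_zero]
    refine (hasDerivAt_const t (0 : ℝ)).congr_of_eventuallyEq ?_
    filter_upwards [Iio_mem_nhds h] with s hs
    simp [max_eq_right (Set.mem_Iio.1 hs).le]
  · rw [max_self, mul_zero, hasDerivAt_iff_isLittleO]
    have h2 : (fun s : ℝ => s ^ 2) =o[nhds 0] fun s : ℝ => s := by
      simpa using Asymptotics.isLittleO_pow_id (𝕜 := ℝ) one_lt_two
    simp only [max_self, sub_zero, smul_zero, ne_eq, OfNat.ofNat_ne_zero, not_false_eq_true,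
      zero_pow]
    refine Asymptotics.IsBigO.trans_isLittleO ?_ h2
    refine Asymptotics.IsBigO.of_bound 1 (Filter.Eventually.of_forall fun s => ?_)
    rw [one_mul, norm_pow, norm_pow]
    gcongr
    rcases le_total s 0 with h | h
    · simp [max_eq_right h]
    · simp [max_eq_left h]
  · rw [max_eq_left h.le]
    have h2 : HasDerivAt (fun s : ℝ => s ^ 2) (2 * t) t := by simpa using hasDerivAt_pow 2 t
    refine h2.congr_of_eventuallyEq ?_
    filter_upwards [Ioi_mem_nhds h] with s hs
    simp [max_eq_left (Set.mem_Ioi.1 hs).le]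

/-- The squared distance of `t` to the interval `[-d, d]`. -/
def hinge (d t : ℝ) : ℝ := max (t - d) 0 ^ 2 + max (-t - d) 0 ^ 2

/-- The derivative of `hinge`. -/
def hingeSlope (d t : ℝ) : ℝ := 2 * max (t - d) 0 - 2 * max (-t - d) 0

theorem hasDerivAt_hinge (d t : ℝ) : HasDerivAt (hinge d) (hingeSlope d t) t := by
  have h1 := (hasDerivAt_max_zero_sq (t - d)).comp t ((hasDerivAt_id t).sub_const d)
  have h2 := (hasDerivAt_max_zero_sq (-t - d)).comp t ((hasDerivAt_id t).neg.sub_const d)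
  exact (h1.add h2).congr_deriv (by simp only [hingeSlope]; ring)

theorem contDiff_hinge (d : ℝ) : ContDiff ℝ 1 (hinge d) := by
  rw [contDiff_one_iff_deriv]
  refine ⟨fun t => (hasDerivAt_hinge d t).differentiableAt, ?_⟩
  rw [show deriv (hinge d) = hingeSlope d from funext fun t => (hasDerivAt_hinge d t).deriv]
  unfold hingeSlope
  fun_prop

theorem hinge_nonneg (d t : ℝ) : 0 ≤ hinge d t := by unfold hinge; positivity

theorem hinge_zero {d : ℝ} (hd : 0 ≤ d) : hinge d 0 = 0 := by simp [hinge, hd]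

theorem abs_le_of_hinge_le {d t τ : ℝ} (hτ : 0 ≤ τ) (h : hinge d t ≤ τ ^ 2) : |t| ≤ d + τ := by
  unfold hinge at h
  have h1 := abs_le_of_sq_le_sq (by nlinarith [sq_nonneg (max (-t - d) 0)] :
    max (t - d) 0 ^ 2 ≤ τ ^ 2) hτ
  have h2 := abs_le_of_sq_le_sq (by nlinarith [sq_nonneg (max (t - d) 0)] :
    max (-t - d) 0 ^ 2 ≤ τ ^ 2) hτ
  have h3 := le_max_left (t - d) 0
  have h4 := le_max_left (-t - d) 0
  exact abs_le.2 ⟨by linarith [(le_abs_self _).trans h2], by linarith [(le_abs_self _).trans h1]⟩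

theorem hingeSlope_nonpos {d t : ℝ} (h : t ≤ d) : hingeSlope d t ≤ 0 := by
  simp [hingeSlope, max_eq_right (sub_nonpos.2 h)]

theorem hingeSlope_nonneg {d t : ℝ} (h : -d ≤ t) : 0 ≤ hingeSlope d t := by
  simp [hingeSlope, max_eq_right (by linarith : -t - d ≤ 0)]

variable {J : ℕ}

/-- The squared distance to a box in the coordinates `⟨ω i, z⟩`, multiplied by `A`. -/
def boxPenalty (A : ℝ) (d : Fin J → ℝ) (ω : Fin J → Space J) (z : Space J) : ℝ :=
  A * ∑ i, hinge (d i) (inner ℝ (ω i) z)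

/-- The gradient of `boxPenalty`. -/
def boxPenaltyGrad (A : ℝ) (d : Fin J → ℝ) (ω : Fin J → Space J) (z : Space J) : Space J :=
  ∑ i, (A * hingeSlope (d i) (inner ℝ (ω i) z)) • ω i

theorem contDiff_boxPenalty (A : ℝ) (d : Fin J → ℝ) (ω : Fin J → Space J) :
    ContDiff ℝ 1 (boxPenalty A d ω) := by
  unfold boxPenalty
  refine contDiff_const.mul (ContDiff.sum fun i _ => (contDiff_hinge (d i)).comp ?_)
  exact (innerSL ℝ (ω i)).contDiff

theorem hasFDerivAt_boxPenalty (A : ℝ) (d : Fin J → ℝ) (ω : Fin J → Space J) (z : Space J) :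
    HasFDerivAt (boxPenalty A d ω) (innerSL ℝ (boxPenaltyGrad A d ω z)) z := by
  have h : ∀ i, HasFDerivAt (fun z => hinge (d i) (inner ℝ (ω i) z))
      (hingeSlope (d i) (inner ℝ (ω i) z) • innerSL ℝ (ω i)) z := fun i =>
    (hasDerivAt_hinge (d i) _).comp_hasFDerivAt z (innerSL ℝ (ω i)).hasFDerivAt
  have h2 := (HasFDerivAt.fun_sum fun i (_ : i ∈ Finset.univ) => h i).const_mul A
  refine h2.congr_fderiv ?_
  ext w
  simp [boxPenaltyGrad, Finset.mul_sum, mul_assoc]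

theorem boxPenalty_zero (A : ℝ) {d : Fin J → ℝ} (hd : ∀ i, 0 ≤ d i) (ω : Fin J → Space J) :
    boxPenalty A d ω 0 = 0 := by
  simp [boxPenalty, hinge_zero (hd _)]

theorem abs_inner_le_of_boxPenalty_le {A τ : ℝ} (hA : 0 < A) (hτ : 0 ≤ τ) {d : Fin J → ℝ}
    {ω : Fin J → Space J} {z : Space J} (h : boxPenalty A d ω z ≤ A * τ ^ 2) (i : Fin J) :
    |inner ℝ (ω i) z| ≤ d i + τ := by
  refine abs_le_of_hinge_le hτ (le_trans ?_ (le_of_mul_le_mul_left h hA))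
  exact Finset.single_le_sum (f := fun i => hinge (d i) (inner ℝ (ω i) z))
    (fun j _ => hinge_nonneg _ _) (Finset.mem_univ i)

namespace Network

variable {K : ℕ} (N : Network J K) {ω : Fin J → Space J} {a : Fin J → ℝ}

theorem inner_boxPenaltyGrad_gamma
    (hdual : ∀ i j, inner ℝ (ω i) (N.gamma j) = if i = j then (1 : ℝ) else 0)
    (A : ℝ) (d : Fin J → ℝ) (z : Space J) (i : Fin J) :
    inner ℝ (boxPenaltyGrad A d ω z) (N.gamma i) =
      A * hingeSlope (d i) (inner ℝ (ω i) z) := by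
  simp [boxPenaltyGrad, sum_inner, real_inner_smul_left, hdual]

/-- By the traffic equation the predecessors of `i` contribute `M (a i - 1)`; the spare `M` absorbs
at most `J` errors `τ`. -/
theorem abs_sum_coeff_le (ha : ∀ i, a i = 1 + ∑ j with N.route j = some i, a j) {M τ : ℝ}
    (hτ : 0 ≤ τ) (hJτ : J * τ ≤ M) {w : Fin J → ℝ} (hw : ∀ i, |w i| ≤ M * a i + τ) (i : Fin J) :
    |∑ j with N.route j = some i, w j| ≤ M * a i := by
  calc |∑ j with N.route j = some i, w j|
      ≤ ∑ j with N.route j = some i, (M * a j + τ) :=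
        (Finset.abs_sum_le_sum_abs _ _).trans (Finset.sum_le_sum fun j _ => hw j)
    _ = M * (a i - 1) + (Finset.card {j | N.route j = some i} : ℕ) * τ := by
        rw [Finset.sum_add_distrib, ← Finset.mul_sum, ha i]; simp
    _ ≤ M * (a i - 1) + J * τ := by
        gcongr
        simpa using Finset.card_le_univ (Finset.univ.filter fun j => N.route j = some i)
    _ ≤ M * a i := by linarith

/-- Here `z i` is the `i`-th dual coordinate minus those of the predecessors of `i`. If `z i ≤ 0`,
that coordinate is at most `M * a i`, hence not beyond the upper face of the box and the slope is
nonpositive; symmetrically if `z i ≥ 0`. -/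
theorem inner_boxPenaltyGrad_gamma_sign
    (hdual : ∀ i j, inner ℝ (ω i) (N.gamma j) = if i = j then (1 : ℝ) else 0)
    (hexp : ∀ z : Space J, z = ∑ j, (inner ℝ (ω j) z : ℝ) • N.gamma j)
    (ha : ∀ i, a i = 1 + ∑ j with N.route j = some i, a j) {A M τ : ℝ} (hA : 0 ≤ A)
    (hτ : 0 ≤ τ) (hJτ : J * τ ≤ M) {z : Space J}
    (hz : ∀ i, |inner ℝ (ω i) z| ≤ M * a i + τ) (i : Fin J) :
    (z i ≤ 0 → inner ℝ (boxPenaltyGrad A (fun i => M * a i) ω z) (N.gamma i) ≤ 0) ∧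
    (0 ≤ z i → 0 ≤ inner ℝ (boxPenaltyGrad A (fun i => M * a i) ω z) (N.gamma i)) := by
  have h1 := N.apply_eq_of_expansion (hexp z) i
  have h2 := abs_le.1 (N.abs_sum_coeff_le ha hτ hJτ hz i)
  rw [N.inner_boxPenaltyGrad_gamma hdual]
  exact ⟨fun h => mul_nonpos_of_nonneg_of_nonpos hA (hingeSlope_nonpos (by linarith)),
    fun h => mul_nonneg hA (hingeSlope_nonneg (by linarith))⟩

end Network

end

/-! ### Doubling of variables -/

variable {J K : ℕ}

theorem gradient_eq_of_hasFDerivAt_innerSL {θ : Space J → ℝ} {p y : Space J}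
    (h : HasFDerivAt θ (innerSL ℝ p) y) : ∇ θ y = p :=
  HasGradientAt.gradient (hasGradientAt_iff_hasFDerivAt.2 (h.congr_fderiv (by ext; simp)))

/-- Freezing one variable gives test functions with gradients `κ⁻¹(σp - δβ)` and `p + δβ`. Scaling
the first by `κ/σ` cancels `p`, so no bound on the penalty gradient is needed. -/
theorem strictness_of_isMax {N : Network J K} {b c C κ σ δ : ℝ} {G X : Set (Space J)}
    {u v g : Space J → ℝ} {β p x₀ y₀ : Space J}
    (hC : ∀ u ∈ N.controls, ∀ m ∈ ratesUpTo J b, ‖N.velocity u m‖ ≤ C)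
    (hu : IsSubsolution N b c G G u) (hv : IsSupersolution N b c G X v)
    (hκ : 0 < κ) (hκσ : κ ≤ σ) (hδ : 0 < δ)
    (hG : ∀ x ∈ G, ∀ i, 0 ≤ x i) (hX : X ⊆ G)
    (hβ : ∀ i, inner ℝ β (N.gamma i) = (1 : ℝ))
    (hg : ContDiff ℝ 1 g) (hp : HasFDerivAt g (innerSL ℝ p) (σ • x₀ - y₀))
    (hsign : ∀ i, ((σ • x₀ - y₀) i ≤ 0 → inner ℝ p (N.gamma i) ≤ (0 : ℝ)) ∧
      (0 ≤ (σ • x₀ - y₀) i → (0 : ℝ) ≤ inner ℝ p (N.gamma i)))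
    (hx₀ : x₀ ∈ G) (hy₀ : y₀ ∈ X)
    (hmax : ∀ x ∈ G, ∀ y ∈ X,
      κ * u x - v y - g (σ • x - y) + δ * inner ℝ β x + δ * inner ℝ β y ≤
      κ * u x₀ - v y₀ - g (σ • x₀ - y₀) + δ * inner ℝ β x₀ + δ * inner ℝ β y₀) :
    (1 - κ / σ) * c ≤ C * (δ * (1 + 1 / κ) * ‖β‖) := by
  have hσ0 : 0 < σ := hκ.trans_le hκσ
  have hβ' : ∀ z, HasFDerivAt (fun x : Space J => δ * inner ℝ β x) (δ • innerSL ℝ β) z :=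
    fun z => (innerSL ℝ β).hasFDerivAt.const_mul δ
  have hβs : ContDiff ℝ 1 (fun x : Space J => δ * (inner ℝ β x : ℝ)) :=
    contDiff_const.mul (innerSL ℝ β).contDiff
  let θ₁ : Space J → ℝ := fun x => κ⁻¹ * (g (σ • x - y₀) - δ * inner ℝ β x)
  let θ₂ : Space J → ℝ := fun y => δ * inner ℝ β y - g (σ • x₀ - y)
  have h₁ : ContDiff ℝ 1 θ₁ :=
    contDiff_const.mul ((hg.comp ((contDiff_id.const_smul σ).sub contDiff_const)).sub hβs)
  have h₂ : ContDiff ℝ 1 θ₂ := hβs.sub (hg.comp (contDiff_const.sub contDiff_id))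
  have hd₁ : ∇ θ₁ x₀ = κ⁻¹ • (σ • p - δ • β) := by
    apply gradient_eq_of_hasFDerivAt_innerSL
    have hlin : HasFDerivAt (fun x : Space J => σ • x - y₀)
        (σ • ContinuousLinearMap.id ℝ (Space J)) x₀ := ((hasFDerivAt_id x₀).const_smul σ).sub_const y₀
    refine (((hp.comp x₀ hlin).sub (hβ' x₀)).const_mul κ⁻¹).congr_fderiv ?_
    ext w
    simp
  have hd₂ : ∇ θ₂ y₀ = p + δ • β := by
    apply gradient_eq_of_hasFDerivAt_innerSL
    have hlin : HasFDerivAt (fun y : Space J => σ • x₀ - y)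
        (-ContinuousLinearMap.id ℝ (Space J)) y₀ := (hasFDerivAt_id y₀).const_sub (σ • x₀)
    refine ((hβ' y₀).sub (hp.comp y₀ hlin)).congr_fderiv ?_
    ext w
    simp [add_comm]
  have hv₁ := hu.viscosity θ₁ h₁ x₀ hx₀ (Filter.eventually_of_mem self_mem_nhdsWithin fun x hx => by
    have h := hmax x hx y₀ hy₀
    have h' := mul_le_mul_of_nonneg_left h (inv_pos.2 hκ).le
    have e : ∀ t, κ⁻¹ * (κ * t) = t := fun t => inv_mul_cancel_left₀ hκ.ne' t
    simp only [θ₁]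
    simp only [mul_add, mul_sub, e] at h' ⊢
    linarith)
  have hv₂ := hv.viscosity θ₂ h₂ y₀ hy₀ (Filter.eventually_of_mem self_mem_nhdsWithin fun y hy => by
    have h := hmax x₀ hx₀ y hy
    simp only [θ₂]
    linarith)
  rw [hd₁] at hv₁
  rw [hd₂] at hv₂
  have hH₁ : 0 ≤ N.hamiltonian b c (κ⁻¹ • (σ • p - δ • β)) := by
    refine hv₁.resolve_right ?_
    rintro ⟨i, hi, h⟩
    -- On the face `x₀ i = 0` the difference has `i`-th coordinate `-y₀ i ≤ 0`.
    have h1 := (hsign i).1 (by simp [hi, hG y₀ (hX hy₀) i])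
    rw [real_inner_smul_left, inner_sub_left, real_inner_smul_left, real_inner_smul_left, hβ] at h
    have h2 := nonneg_of_mul_nonneg_right h (inv_pos.2 hκ)
    nlinarith
  have hH₂ : N.hamiltonian b c (p + δ • β) ≤ 0 := by
    refine hv₂.resolve_right ?_
    rintro ⟨i, hi, h⟩
    have h1 := (hsign i).2 (by simp [hi]; exact mul_nonneg hσ0.le (hG x₀ hx₀ i))
    rw [inner_add_left, real_inner_smul_left, hβ] at h
    linarith
  refine N.hamiltonian_strict_contraction (div_nonneg hκ.le hσ0.le) ((div_le_one hσ0).2 hκσ)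
    hC hH₁ hH₂ ?_
  have e : (κ / σ) • κ⁻¹ • (σ • p - δ • β) - (p + δ • β) = -((δ * (1 + 1 / σ)) • β) := by
    rw [smul_smul, show κ / σ * κ⁻¹ = σ⁻¹ by field_simp, smul_sub, smul_smul, smul_smul,
      inv_mul_cancel₀ hσ0.ne']
    module
  rw [e, norm_neg, norm_smul, Real.norm_eq_abs, abs_of_nonneg (by positivity)]
  gcongr

theorem exists_pos_lt_mul_lt {B ε m : ℝ} (hB : 0 ≤ B) (hε : 0 < ε) (hm : 0 < m) :
    ∃ t, 0 < t ∧ t < m ∧ t * B < ε := by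
  refine ⟨min (m / 2) (ε / (B + 1)), by positivity, (min_le_left _ _).trans_lt (by linarith), ?_⟩
  calc min (m / 2) (ε / (B + 1)) * B ≤ ε / (B + 1) * B := by gcongr; exact min_le_right _ _
    _ < ε := by
      rw [div_mul_eq_mul_div, div_lt_iff₀ (by positivity)]
      nlinarith

theorem sub_le_of_lipschitzOnWith {w : Space J → ℝ} {S : Set (Space J)} {L' : NNReal} {L : ℝ}
    (hw : LipschitzOnWith L' w S) (hL : L' ≤ L) {x y : Space J} (hx : x ∈ S) (hy : y ∈ S) :
    w x - w y ≤ L * ‖x - y‖ := by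
  have h := hw.dist_le_mul x hx y hy
  rw [Real.dist_eq, dist_eq_norm] at h
  exact (le_abs_self _).trans (h.trans (by gcongr))

theorem mem_exitBoundary {G : Set (Space J)} {x : Space J} (hx : x ∈ closure G) (h : x ∉ G) :
    x ∈ exitBoundary G :=
  ⟨⟨hx, fun hi => h (interior_subset hi)⟩, h⟩

/-- Comparison on a bounded domain that admits contractions, arbitrarily close to the identity, into the
complement of the blocked part of the boundary. -/
theorem comparison_of_contractions {N : Network J K} {b c : ℝ} (hc : 0 < c)
    {G Gc : Set (Space J)} {u v : Space J → ℝ}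
    (hu : IsSubsolution N b c G G u) (hv : IsSupersolution N b c G (G \ Gc) v)
    (hbdd : Bornology.IsBounded G) (hpos : ∀ x ∈ G, ∀ i, 0 ≤ x i)
    (hcl : closure (G \ Gc) = closure G)
    (hcontr : ∀ ε > (0 : ℝ), ∃ σ : ℝ, 1 - ε < σ ∧ σ ≤ 1 ∧ (∀ x ∈ closure G, σ • x ∈ closure G) ∧
      ∃ ζ > (0 : ℝ), ∀ x ∈ closure G, ∀ y ∈ Gc, ζ ≤ ‖σ • x - y‖) :
    ∀ x ∈ G, u x ≤ v x := by
  intro z₀ hz₀G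
  by_contra! hlt
  set S := closure G with hS
  have hz₀ : z₀ ∈ S := subset_closure hz₀G
  have hScomp : IsCompact S := hbdd.isCompact_closure
  obtain ⟨R, hR0, hR⟩ : ∃ R : ℝ, 0 < R ∧ ∀ x ∈ S, ‖x‖ ≤ R := by
    obtain ⟨R, hR0, hR⟩ := hScomp.isBounded.exists_pos_norm_le
    exact ⟨R, hR0, hR⟩
  obtain ⟨Lu, hLu⟩ := hu.lipschitz
  obtain ⟨Lv, hLv⟩ := hv.lipschitz
  rw [hcl] at hLv
  let L : ℝ := Lu + Lv
  have hL : 0 ≤ L := add_nonneg Lu.2 Lv.2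
  have hlu : ∀ {x y}, x ∈ S → y ∈ S → u x - u y ≤ L * ‖x - y‖ := fun hx hy =>
    sub_le_of_lipschitzOnWith hLu (by simp [L]) hx hy
  have hlv : ∀ {x y}, x ∈ S → y ∈ S → v x - v y ≤ L * ‖x - y‖ := fun hx hy =>
    sub_le_of_lipschitzOnWith hLv (by simp [L]) hx hy
  obtain ⟨Bu, hBu⟩ := hScomp.exists_bound_of_continuousOn hLu.continuousOn
  obtain ⟨Bv, hBv⟩ := hScomp.exists_bound_of_continuousOn hLv.continuousOn
  simp only [Real.norm_eq_abs] at hBu hBv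
  obtain ⟨ω, a, hdual, hexp, ha0, ha⟩ := N.exists_dual_basis
  obtain ⟨C, hC0, hC⟩ := N.exists_norm_velocity_le b
  let β : Space J := ∑ i, ω i
  have hβ : ∀ i, inner ℝ β (N.gamma i) = (1 : ℝ) := fun i => by
    simp [β, sum_inner, hdual]
  have hβR : ∀ x ∈ S, |inner ℝ β x| ≤ ‖β‖ * R := fun x hx =>
    (abs_real_inner_le_norm _ _).trans (by gcongr; exact hR x hx)
  let D : ℝ := ∑ j, (a j + 1) * ‖N.gamma j‖
  have hD : 0 ≤ D := Finset.sum_nonneg fun j _ =>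
    mul_nonneg (by linarith [ha0 j]) (norm_nonneg _)
  set η := u z₀ - v z₀ with hη
  have hη0 : 0 < η := sub_pos.2 hlt
  -- choice of the parameters
  obtain ⟨t, ht0, ht1, ht⟩ := exists_pos_lt_mul_lt (abs_nonneg (u z₀))
    (by positivity : 0 < η / 5) one_half_pos
  obtain ⟨s, hs0, hst, hs⟩ := exists_pos_lt_mul_lt (by positivity : 0 ≤ 2 * L * R)
    (by positivity : 0 < η / 5) ht0
  obtain ⟨σ, hσs, hσ1, hσS, ζ, hζ0, hζ⟩ := hcontr s hs0
  let κ := 1 - t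
  have hκ0 : 0 < κ := by simp only [κ]; linarith
  have hκ1 : κ ≤ 1 := by simp only [κ]; linarith
  have hκσ : κ < σ := by simp only [κ]; linarith
  have hσ0 : 0 < σ := hκ0.trans hκσ
  have hgap : 0 < (1 - κ / σ) * c := mul_pos (sub_pos.2 ((div_lt_one hσ0).2 hκσ)) hc
  obtain ⟨δ, hδ0, hδ1, hδ⟩ := exists_pos_lt_mul_lt
    (by positivity : 0 ≤ 4 * ‖β‖ * R + C * (1 + 1 / κ) * ‖β‖)
    (lt_min (by positivity : 0 < η / 5) hgap) one_pos
  have hδη : δ * (4 * ‖β‖ * R) < η / 5 := by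
    refine lt_of_le_of_lt ?_ (hδ.trans_le (min_le_left _ _))
    gcongr
    exact le_add_of_nonneg_right (by positivity)
  have hδc : C * (δ * (1 + 1 / κ) * ‖β‖) < (1 - κ / σ) * c := by
    refine lt_of_le_of_lt ?_ (hδ.trans_le (min_le_right _ _))
    have : 0 ≤ δ * (4 * ‖β‖ * R) := by positivity
    linarith
  obtain ⟨M, hM0, -, hM⟩ := exists_pos_lt_mul_lt (by positivity : 0 ≤ D + L * D)
    (lt_min (by positivity : 0 < η / 5) hζ0) one_pos
  have hMη : L * (M * D) < η / 5 := by
    have : 0 ≤ M * D := by positivity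
    linarith [hM.trans_le (min_le_left _ _)]
  have hMζ : M * D < ζ := by
    have : 0 ≤ M * (L * D) := by positivity
    linarith [hM.trans_le (min_le_right _ _)]
  let τ : ℝ := M / (J + 1)
  have hτ0 : 0 < τ := by positivity
  have hJτ : J * τ ≤ M := by
    simp only [τ]
    rw [← mul_div_assoc, div_le_iff₀ (by positivity)]
    linarith
  have hτM : τ ≤ M := div_le_self hM0.le (by linarith [(Nat.cast_nonneg J : (0 : ℝ) ≤ J)])
  let B : ℝ := 2 * |Bu| + 2 * |Bv| + 4 * ‖β‖ * R
  have hB0 : 0 ≤ B := by positivity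
  -- Comparison with `(z₀, σ • z₀)`, where the penalty vanishes, bounds the penalty at the maximum
  -- by `B`; this `A` turns that into a distance at most `τ` from the box.
  let A : ℝ := (B + 1) / τ ^ 2
  have hA0 : 0 < A := by positivity
  have hAB : B ≤ A * τ ^ 2 := by
    simp only [A]
    rw [div_mul_cancel₀ _ (by positivity)]
    linarith
  let d : Fin J → ℝ := fun i => M * a i
  let g := boxPenalty A d ω
  have hg : ContDiff ℝ 1 g := contDiff_boxPenalty A d ω
  -- the maximum point
  let F : Space J × Space J → ℝ := fun p =>
    κ * u p.1 - v p.2 - g (σ • p.1 - p.2) + δ * inner ℝ β p.1 + δ * inner ℝ β p.2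
  have hF : ContinuousOn F (S ×ˢ S) := by
    have h1 : ContinuousOn (fun p : Space J × Space J => u p.1) (S ×ˢ S) :=
      hLu.continuousOn.comp continuousOn_fst fun p hp => hp.1
    have h2 : ContinuousOn (fun p : Space J × Space J => v p.2) (S ×ˢ S) :=
      hLv.continuousOn.comp continuousOn_snd fun p hp => hp.2
    have h3 : Continuous fun p : Space J × Space J => g (σ • p.1 - p.2) :=
      hg.continuous.comp (by fun_prop)
    have h4 : Continuous fun p : Space J × Space J => δ * (inner ℝ β p.1 : ℝ) := by fun_prop
    have h5 : Continuous fun p : Space J × Space J => δ * (inner ℝ β p.2 : ℝ) := by fun_prop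
    exact ((((h1.const_smul κ).sub h2).sub h3.continuousOn).add h4.continuousOn).add
      h5.continuousOn
  obtain ⟨⟨x₀, y₀⟩, ⟨hx₀, hy₀⟩, hmax⟩ :=
    (hScomp.prod hScomp).exists_isMaxOn ⟨(z₀, z₀), hz₀, hz₀⟩ hF
  have hmax' : ∀ x ∈ S, ∀ y ∈ S, F (x, y) ≤ F (x₀, y₀) := fun x hx y hy => hmax ⟨hx, hy⟩
  simp only [F] at hmax'
  have hδβ : ∀ x ∈ S, |δ * inner ℝ β x| ≤ δ * (‖β‖ * R) := fun x hx => by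
    rw [abs_mul, abs_of_pos hδ0]
    exact mul_le_mul_of_nonneg_left (hβR x hx) hδ0.le
  have hδ1' : δ * (‖β‖ * R) ≤ ‖β‖ * R := mul_le_of_le_one_left (by positivity) hδ1.le
  have hbase := hmax' z₀ hz₀ (σ • z₀) (hσS z₀ hz₀)
  rw [sub_self, show g 0 = 0 from boxPenalty_zero A (fun i => mul_nonneg hM0.le (ha0 i)) ω,
    sub_zero] at hbase
  have e1 := abs_le.1 (hδβ z₀ hz₀)
  have e2 := abs_le.1 (hδβ _ (hσS z₀ hz₀))
  have e3 := abs_le.1 (hδβ x₀ hx₀)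
  have e4 := abs_le.1 (hδβ y₀ hy₀)
  have hκu : ∀ x ∈ S, |κ * u x| ≤ |Bu| := fun x hx => by
    rw [abs_mul, abs_of_pos hκ0]
    exact (mul_le_of_le_one_left (abs_nonneg _) hκ1).trans ((hBu x hx).trans (le_abs_self _))
  have hpen : g (σ • x₀ - y₀) ≤ A * τ ^ 2 := by
    refine le_trans ?_ hAB
    have f1 := abs_le.1 (hκu z₀ hz₀)
    have f2 := abs_le.1 (hκu x₀ hx₀)
    have f3 := abs_le.1 ((hBv _ (hσS z₀ hz₀)).trans (le_abs_self Bv))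
    have f4 := abs_le.1 ((hBv y₀ hy₀).trans (le_abs_self Bv))
    simp only [B]
    linarith [f1.1, f2.2, f3.2, f4.1, e1.1, e2.1, e3.2, e4.2]
  have hω : ∀ i, |inner ℝ (ω i) (σ • x₀ - y₀)| ≤ M * a i + τ :=
    abs_inner_le_of_boxPenalty_le hA0 hτ0.le hpen
  have hdist : ‖σ • x₀ - y₀‖ ≤ M * D := by
    rw [hexp (σ • x₀ - y₀)]
    simp only [D, Finset.mul_sum]
    refine (norm_sum_le _ _).trans (Finset.sum_le_sum fun j _ => ?_)
    rw [norm_smul, Real.norm_eq_abs, ← mul_assoc]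
    gcongr
    linarith [hω j]
  have hdist' : ∀ x ∈ S, ‖x - σ • x‖ ≤ s * R := fun x hx => by
    rw [show x - σ • x = (1 - σ) • x by module, norm_smul, Real.norm_eq_abs,
      abs_of_nonneg (by linarith)]
    exact mul_le_mul (by linarith) (hR x hx) (norm_nonneg _) hs0.le
  have hxy : L * ‖x₀ - y₀‖ < 2 * (η / 5) - L * (s * R) := by
    have h1 : ‖x₀ - y₀‖ ≤ s * R + M * D := by
      rw [show x₀ - y₀ = (x₀ - σ • x₀) + (σ • x₀ - y₀) by abel]
      exact (norm_add_le _ _).trans (add_le_add (hdist' x₀ hx₀) hdist)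
    have h2 := mul_le_mul_of_nonneg_left h1 hL
    linarith
  -- the maximum is positive
  have hval : L * ‖x₀ - y₀‖ < κ * u x₀ - v y₀ := by
    have h1 : v (σ • z₀) - v z₀ ≤ L * (s * R) :=
      (hlv (hσS z₀ hz₀) hz₀).trans (mul_le_mul_of_nonneg_left (by
        rw [norm_sub_rev]; exact hdist' z₀ hz₀) hL)
    have h2 : u z₀ - κ * u z₀ < η / 5 := by
      have : u z₀ - κ * u z₀ = t * u z₀ := by simp only [κ]; ring
      rw [this]
      exact (mul_le_mul_of_nonneg_left (le_abs_self _) ht0.le).trans_lt ht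
    have h3 : 0 ≤ g (σ • x₀ - y₀) :=
      mul_nonneg hA0.le (Finset.sum_nonneg fun i _ => hinge_nonneg _ _)
    linarith [e1.1, e2.1, e3.2, e4.2]
  have hx₀G : x₀ ∈ G := by
    -- On the exit boundary `u ≤ 0 ≤ v`, so `κ u x₀ - v y₀ ≤ v x₀ - v y₀ ≤ L ‖x₀ - y₀‖`, against
    -- `hval`.
    by_contra h
    have hb := mem_exitBoundary hx₀ h
    have h1 := hu.boundary x₀ ⟨hx₀, hb⟩
    have h2 := hv.boundary x₀ ⟨hcl ▸ hx₀, hb⟩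
    have h3 := hlv hx₀ hy₀
    have h4 := mul_nonpos_of_nonneg_of_nonpos hκ0.le h1
    linarith
  have hy₀G : y₀ ∈ G := by
    by_contra h
    have hb := mem_exitBoundary hy₀ h
    have h1 := hu.boundary y₀ ⟨hy₀, hb⟩
    have h2 := hv.boundary y₀ ⟨hcl ▸ hy₀, hb⟩
    have h3 := mul_le_mul_of_nonneg_left (hlu hx₀ hy₀) hκ0.le
    have h4 := mul_nonpos_of_nonneg_of_nonpos hκ0.le h1
    have h5 : κ * (L * ‖x₀ - y₀‖) ≤ L * ‖x₀ - y₀‖ := mul_le_of_le_one_left (by positivity) hκ1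
    linarith
  -- `y₀` lies within `M * D < ζ` of `σ • x₀`.
  have hy₀c : y₀ ∉ Gc := fun h => absurd (hζ x₀ hx₀ y₀ h) (by linarith)
  have hfinal := strictness_of_isMax (c := c) hC hu hv hκ0 hκσ.le hδ0 hpos Set.sdiff_subset hβ hg
    (hasFDerivAt_boxPenalty A d ω (σ • x₀ - y₀))
    (N.inner_boxPenaltyGrad_gamma_sign hdual hexp ha hA0.le hτ0.le hJτ hω) hx₀G ⟨hy₀G, hy₀c⟩
    (fun x hx y hy => hmax' x (subset_closure hx) y (subset_closure hy.1))
  linarith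

/-! ### The two types of domains -/

namespace Network

variable (N : Network J K) {z : Fin J → ℝ}

theorem le_of_mem_rectangle {x : Space J} (hx : x ∈ N.rectangle z) (i : Fin J) : x i ≤ z i := by
  by_cases h : 0 < N.lam i
  · exact ((hx i).2.1 h).le
  · exact (hx i).2.2 h

theorem smul_mem_rectangle {x : Space J} (hx : x ∈ N.rectangle z) {σ : ℝ} (h0 : 0 ≤ σ)
    (h1 : σ ≤ 1) : σ • x ∈ N.rectangle z := fun i => by
  have hle : σ * x i ≤ x i := mul_le_of_le_one_left (hx i).1 h1
  exact ⟨mul_nonneg h0 (hx i).1, fun h => hle.trans_lt ((hx i).2.1 h),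
    fun h => hle.trans ((hx i).2.2 h)⟩

theorem isBounded_rectangle : Bornology.IsBounded (N.rectangle z) := by
  refine (Metric.isBounded_closedBall (x := (0 : Space J)) (r := ∑ i, |z i|)).subset fun x hx => ?_
  rw [mem_closedBall_zero_iff, EuclideanSpace.norm_eq]
  refine Real.sqrt_le_iff.2 ⟨by positivity, ?_⟩
  refine (Finset.sum_le_sum fun i _ => ?_).trans
    (Finset.sum_sq_le_sq_sum_of_nonneg fun i _ => abs_nonneg (z i))
  rw [Real.norm_eq_abs]
  refine pow_le_pow_left₀ (abs_nonneg _) (abs_le_abs_of_nonneg (hx i).1 ?_) 2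
  exact N.le_of_mem_rectangle hx i

theorem smul_notMem_rectangleBlocked (hz : ∀ i, 0 < z i) {x : Space J} (hx : x ∈ N.rectangle z)
    {σ : ℝ} (h1 : σ < 1) (h0 : 0 ≤ σ) : σ • x ∉ N.rectangleBlocked z := by
  rintro ⟨-, j, -, hj⟩
  have h : σ * x j = z j := hj
  have := mul_le_mul_of_nonneg_left (N.le_of_mem_rectangle hx j) h0
  nlinarith [hz j]

theorem closure_rectangle_diff (hz : ∀ i, 0 < z i) :
    closure (N.rectangle z \ N.rectangleBlocked z) = closure (N.rectangle z) := by
  refine (closure_mono Set.sdiff_subset).antisymm (closure_minimal (fun x hx => ?_) isClosed_closure)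
  have ht : Filter.Tendsto (fun t : ℝ => t • x) (nhdsWithin 1 (Set.Iio 1)) (nhds x) := by
    have h : Continuous fun t : ℝ => t • x := by fun_prop
    simpa using (h.tendsto 1).mono_left nhdsWithin_le_nhds
  refine mem_closure_of_tendsto ht ?_
  filter_upwards [Ioo_mem_nhdsLT (zero_lt_one (α := ℝ))] with t ht
  exact ⟨N.smul_mem_rectangle hx ht.1.le ht.2.le,
    N.smul_notMem_rectangleBlocked hz hx ht.2 ht.1.le⟩

/-- A blocked point has some `y j = z j`, while scaling by `1 - t` gives a coordinate at most `(1 -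
t) z j`; the gap is at least `t` times the shortest side. -/
theorem exists_contraction_rectangle (hz : ∀ i, 0 < z i) {ε : ℝ} (hε : 0 < ε) :
    ∃ σ : ℝ, 1 - ε < σ ∧ σ ≤ 1 ∧
      (∀ x ∈ closure (N.rectangle z), σ • x ∈ closure (N.rectangle z)) ∧
      ∃ ζ > (0 : ℝ), ∀ x ∈ closure (N.rectangle z), ∀ y ∈ N.rectangleBlocked z,
        ζ ≤ ‖σ • x - y‖ := by
  obtain ⟨t, ht0, ht1, ht⟩ := exists_pos_lt_mul_lt zero_le_one hε one_pos
  obtain ⟨w, hw0, hw⟩ : ∃ w > (0 : ℝ), ∀ i, w ≤ z i := by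
    rcases isEmpty_or_nonempty (Fin J) with h | h
    · exact ⟨1, one_pos, fun i => h.elim i⟩
    · obtain ⟨i, hi⟩ := Finite.exists_min z
      exact ⟨z i, hz i, hi⟩
  refine ⟨1 - t, by linarith, by linarith, fun x hx => ?_, t * w, by positivity,
    fun x hx y hy => ?_⟩
  · exact map_mem_closure (f := fun x : Space J => (1 - t) • x) (by fun_prop) hx fun y hy =>
      N.smul_mem_rectangle hy (by linarith) (by linarith)
  · obtain ⟨-, j, -, hj⟩ := hy
    have hxj : x j ≤ z j := by
      have hcl : IsClosed {x : Space J | x j ≤ z j} :=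
        isClosed_le (by fun_prop) continuous_const
      exact closure_minimal (fun y hy => N.le_of_mem_rectangle hy j) hcl hx
    have h1 : |((1 - t) • x - y) j| ≤ ‖(1 - t) • x - y‖ := by
      rw [← Real.norm_eq_abs]
      exact PiLp.norm_apply_le ((1 - t) • x - y) j
    refine le_trans ?_ ((neg_le_abs _).trans h1)
    have h2 : ((1 - t) • x - y) j = (1 - t) * x j - y j := rfl
    rw [h2, hj]
    nlinarith [mul_le_mul_of_nonneg_left hxj (by linarith : 0 ≤ 1 - t),
      mul_le_mul_of_nonneg_left (hw j) ht0.le]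

end Network

end EscapeTime

end

theorem theorem5 {J K : ℕ} (N : EscapeTime.Network J K) (b c : ℝ) (hb : 0 < b) (hc : 0 < c)
    (G Gc : Set (EscapeTime.Space J)) (hG : N.IsDomain G Gc)
    (u v : EscapeTime.Space J → ℝ)
    (hu : EscapeTime.IsSubsolution N b c G G u)
    (hv : EscapeTime.IsSupersolution N b c G (G \ Gc) v) :
    ∀ x ∈ G, u x ≤ v x := by
  cases hG with
  | rectangle z hz =>
    exact EscapeTime.comparison_of_contractions hc hu hv N.isBounded_rectangle
      (fun x hx i => (hx i).1) (N.closure_rectangle_diff hz)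
      fun ε hε => N.exists_contraction_rectangle hz hε
  | subgraph phi hpos hlip hbdd hsc =>
    -- With no blocked boundary, `σ = 1` works and the separation condition is vacuous.
    refine EscapeTime.comparison_of_contractions hc hu hv hbdd (fun x hx i => hx.1 i)
      (by rw [Set.sdiff_empty]) fun ε hε => ⟨1, by linarith, le_rfl, fun x hx => ?_, 1, one_pos, ?_⟩
    · rwa [one_smul]
    · simp
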